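/- Let $G$ be a totally disconnected, locally compact topological group (not necessarily metrizable) and let $\alpha$ be an automorphism of the topological group $G$. For a topological group $L$ and an automorphism $\beta$ of $L$, a compact open subgroup $V\subseteq L$ is called tidy for $\beta$ if $V=V_+V_-$, where $V_{\pm}:=\bigcap_{n\ge 0}\beta^{\pm n}(V)$, and if both $V_{++}:=\bigcup_{n\ge 0}\beta^{n}(V_+)$ and $V_{--}:=\bigcup_{n\ge 0}\beta^{-n}(V_-)$ are closed in $L$; the automorphism $\beta$ is called tidy if every identity neighbourhood of $L$ contains a subgroup tidy for $\beta$. Let $M_\alpha:=\{x\in G : \{\alpha^n(x):n\in\mathbb Z\}\text{ is relatively compact in }G\}$, which is an $\alpha$-stable subgroup of $G$, and let $U_\alpha:=\{x\in G:\lim_{n\to\infty}\alpha^n(x)=1\}$. For a subset $H\subseteq G$, let $U_{\alpha/H}$ be the set of all $x\in G$ such that for every identity neighbourhood $V\subseteq G$ there exists $N\in\mathbb N$ with $\alpha^n(x)\in VH$ for all $n\ge N$. Let $H$ be a closed subgroup of $G$ with $\alpha(H)=H$. If the restriction $\alpha|_{M_\alpha}$ of $\alpha$ to $M_\alpha$ (with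 the subspace topology) is tidy, then $$U_{\alpha/H}=U_\alpha H.$$ -/

import Mathlib

open Filter Topology
open scoped Pointwise

namespace TidyAut

section Defs

variable {G : Type*} [Group G] [TopologicalSpace G]

/-- The integer power `α ^ n` of a topological group automorphism, as a group automorphism. -/
def iter (α : G ≃ₜ* G) (n : ℤ) : MulAut G :=
  (α.toMulEquiv : MulAut G) ^ n

/-- `H` is `α`-stable: `α(H) = H`. -/
def IsStable (α : G ≃ₜ* G) (H : Subgroup G) : Prop :=
  H.map (α.toMulEquiv.toMonoidHom) = H

theorem IsStable.apply_mem {α : G ≃ₜ* G} {H : Subgroup G} (h : IsStable α H) {x : G}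
    (hx : x ∈ H) : α x ∈ H := by
  have h1 : α x ∈ H.map (α.toMulEquiv.toMonoidHom) := ⟨x, hx, rfl⟩
  rwa [h] at h1

theorem IsStable.symm_apply_mem {α : G ≃ₜ* G} {H : Subgroup G} (h : IsStable α H) {x : G}
    (hx : x ∈ H) : α.symm x ∈ H := by
  rw [← h] at hx
  obtain ⟨y, hy, rfl⟩ := hx
  have : α.symm (α y) = y := α.symm_apply_apply y
  exact this.symm ▸ hy

/-- The restriction `α|_H` of `α` to an `α`-stable subgroup `H` (with the subspace topology). -/
def restrict (α : G ≃ₜ* G) (H : Subgroup G) (h : IsStable α H) : H ≃ₜ* H where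
  toFun x := ⟨α x, h.apply_mem x.2⟩
  invFun x := ⟨α.symm x, h.symm_apply_mem x.2⟩
  left_inv x := Subtype.ext (α.symm_apply_apply x)
  right_inv x := Subtype.ext (α.apply_symm_apply x)
  map_mul' x y := Subtype.ext (map_mul α (x : G) (y : G))
  continuous_toFun := (α.continuous.comp continuous_subtype_val).subtype_mk _
  continuous_invFun := (α.symm.continuous.comp continuous_subtype_val).subtype_mk _

/-- `V₊ = ⋂_{n ≥ 0} αⁿ(V)`. -/
def plus (α : G ≃ₜ* G) (V : Subgroup G) : Subgroup G :=
  ⨅ n : ℕ, V.map (iter α n).toMonoidHom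

/-- `V₋ = ⋂_{n ≥ 0} α⁻ⁿ(V)`. -/
def minus (α : G ≃ₜ* G) (V : Subgroup G) : Subgroup G :=
  ⨅ n : ℕ, V.map (iter α (-n)).toMonoidHom

/-- `V₊₊ = ⋃_{n ≥ 0} αⁿ(V₊)`. -/
def plusPlus (α : G ≃ₜ* G) (V : Subgroup G) : Set G :=
  ⋃ n : ℕ, iter α n '' (plus α V : Set G)

/-- `V₋₋ = ⋃_{n ≥ 0} α⁻ⁿ(V₋)`. -/
def minusMinus (α : G ≃ₜ* G) (V : Subgroup G) : Set G :=
  ⋃ n : ℕ, iter α (-n) '' (minus α V : Set G)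

/-- A compact open subgroup `V` is tidy for `α` if `V = V₊V₋` and `V₊₊`, `V₋₋` are closed. -/
structure IsTidySubgroup (α : G ≃ₜ* G) (V : Subgroup G) : Prop where
  isCompact : IsCompact (V : Set G)
  isOpen : IsOpen (V : Set G)
  eq_mul : (V : Set G) = (plus α V : Set G) * (minus α V : Set G)
  isClosed_plusPlus : IsClosed (plusPlus α V)
  isClosed_minusMinus : IsClosed (minusMinus α V)

/-- `α` is tidy: there are arbitrarily small subgroups tidy for `α`. -/
def IsTidy (α : G ≃ₜ* G) : Prop :=
  ∀ Y ∈ 𝓝 (1 : G), ∃ V : Subgroup G, IsTidySubgroup α V ∧ (V : Set G) ⊆ Y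

/-- The contraction group `U_α`, as a subset of `G`. -/
def contractionSet (α : G ≃ₜ* G) : Set G :=
  {x | Tendsto (fun n : ℕ => iter α n x) atTop (𝓝 1)}

/-- The set `U_{α/H}` of all `x` with `lim αⁿ(x) = 1 mod H`: for each identity neighbourhood `V`,
eventually `αⁿ(x) ∈ VH`. -/
def contractionSetMod (α : G ≃ₜ* G) (H : Set G) : Set G :=
  {x | ∀ V ∈ 𝓝 (1 : G), ∃ N : ℕ, ∀ n : ℕ, N ≤ n → iter α n x ∈ V * H}

variable [IsTopologicalGroup G]

/-- The Levi factor `M_α`: all `x` whose two-sided orbit `{αⁿ(x) : n ∈ ℤ}` is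
relatively compact. -/
def levi (α : G ≃ₜ* G) : Subgroup G where
  carrier := {x | IsCompact (closure (Set.range fun n : ℤ => iter α n x))}
  one_mem' := by
    refine isCompact_singleton.closure_of_subset (K := {(1 : G)}) ?_
    rintro _ ⟨n, rfl⟩
    simp
  mul_mem' := by
    intro x y hx hy
    refine (IsCompact.mul hx hy).closure_of_subset ?_
    rintro _ ⟨n, rfl⟩
    refine ⟨iter α n x, subset_closure ⟨n, rfl⟩, iter α n y, subset_closure ⟨n, rfl⟩, ?_⟩
    simp
  inv_mem' := by
    intro x hx
    refine (IsCompact.inv hx).closure_of_subset ?_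
    rintro _ ⟨n, rfl⟩
    rw [Set.mem_inv]
    refine subset_closure ⟨n, ?_⟩
    simp

theorem mem_levi {α : G ≃ₜ* G} {x : G} :
    x ∈ levi α ↔ IsCompact (closure (Set.range fun n : ℤ => iter α n x)) :=
  Iff.rfl

/-- `M_α` is `α`-stable. -/
theorem isStable_levi (α : G ≃ₜ* G) : IsStable α (levi α) := by
  have key : ∀ x : G, (Set.range fun n : ℤ => iter α n (α x)) =
      Set.range fun n : ℤ => iter α n x := by
    intro x
    have h : ∀ n : ℤ, iter α n (α x) = iter α (n + 1) x := by
      intro n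
      simp only [iter, zpow_add, zpow_one, MulAut.mul_apply]
      rfl
    simp only [h]
    exact (Equiv.addRight (1 : ℤ)).surjective.range_comp (fun n : ℤ => iter α n x)
  have hiff : ∀ x : G, α x ∈ levi α ↔ x ∈ levi α := by
    intro x
    rw [mem_levi, mem_levi, key]
  apply le_antisymm
  · rintro _ ⟨x, hx, rfl⟩
    exact (hiff x).2 hx
  · intro x hx
    have hs : α (α.symm x) = x := α.apply_symm_apply x
    exact ⟨α.symm x, (hiff _).1 (hs.symm ▸ hx), hs⟩

end Defs

end TidyAut

namespace TidyAut

/-! ### Integer iterates of `α` and the groups `V₊`, `V₋` -/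

section Iter

variable {G : Type*} [Group G] [TopologicalSpace G]

/-! Only `U_{α/H} ⊆ U_α H` needs an argument, and it comes down to replacing `H` by a compact group.
Fix a compact open subgroup `V`. After passing to some `αᴺ(x)` and correcting by an element of `H`,
one gets `u` whose whole forward orbit lies in `V` (`exists_forward_orbit_mem`). The cluster points
of that orbit lie in `K`, the largest `α`-stable subgroup of `V ∩ H`, so `u ∈ U_{α/K}`
(`mem_contractionSetMod_stableCore`).

The compact group `K` lies in `M_α`. All orbits in `M_α` are relatively compact, so subgroups tidy
for the restriction are in fact stable (`IsTidySubgroup.isStable`), and `K` has arbitrarily small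
relatively open `α`-stable subgroups `W`. For each such `W`, the `k ∈ K` with `uk ∈ U_{α/W}` form
exactly one left coset of `W`. By compactness of `K` these cosets have a common point `k`, and then
`uk ∈ U_α`. Using all `W` at once, rather than a sequence, avoids metrizability. -/

theorem iter_iter (α : G ≃ₜ* G) (m n : ℤ) (x : G) :
    iter α m (iter α n x) = iter α (m + n) x := by
  simp only [iter, zpow_add, MulAut.mul_apply]

@[simp]
theorem iter_zero (α : G ≃ₜ* G) (x : G) : iter α 0 x = x := by
  simp [iter]

theorem iter_one (α : G ≃ₜ* G) (x : G) : iter α 1 x = α x := by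
  simp only [iter, zpow_one]
  rfl

theorem iter_neg_one (α : G ≃ₜ* G) (x : G) : iter α (-1) x = α.symm x := by
  simp only [iter, zpow_neg, zpow_one]
  rfl

theorem iter_symm (α : G ≃ₜ* G) (n : ℤ) : iter α.symm n = iter α (-n) := by
  have h : (α.symm.toMulEquiv : MulAut G) = (α.toMulEquiv : MulAut G)⁻¹ := rfl
  rw [iter, h, inv_zpow', iter]

theorem apply_iter (α : G ≃ₜ* G) (n : ℤ) (x : G) : α (iter α n x) = iter α (n + 1) x := by
  rw [← iter_one, iter_iter, add_comm]

theorem iter_apply (α : G ≃ₜ* G) (n : ℤ) (x : G) : iter α n (α x) = iter α (n + 1) x := by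
  rw [← iter_one, iter_iter]

theorem iter_neg_iter (α : G ≃ₜ* G) (n : ℤ) (x : G) : iter α (-n) (iter α n x) = x := by
  rw [iter_iter, neg_add_cancel, iter_zero]

theorem iter_iter_neg (α : G ≃ₜ* G) (n : ℤ) (x : G) : iter α n (iter α (-n) x) = x := by
  rw [iter_iter, add_neg_cancel, iter_zero]

theorem continuous_iter (α : G ≃ₜ* G) (n : ℤ) : Continuous (iter α n) := by
  induction n with
  | zero => exact continuous_id.congr fun x => (iter_zero α x).symm
  | succ n ih => exact (α.continuous.comp ih).congr fun x => apply_iter α n x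
  | pred n ih =>
    refine (α.symm.continuous.comp ih).congr fun x => ?_
    have : α.symm (iter α (-n) x) = iter α (-n - 1) x := by
      rw [← iter_neg_one, iter_iter, show (-1 + -(n : ℤ)) = -n - 1 by ring]
    exact this

theorem isStable_of_mem {α : G ≃ₜ* G} {H : Subgroup G} (h : ∀ x ∈ H, α x ∈ H)
    (h' : ∀ x ∈ H, α.symm x ∈ H) : IsStable α H := by
  apply le_antisymm
  · rintro _ ⟨x, hx, rfl⟩
    exact h x hx
  · intro x hx
    exact ⟨α.symm x, h' x hx, α.apply_symm_apply x⟩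

theorem IsStable.iter_mem {α : G ≃ₜ* G} {H : Subgroup G} (h : IsStable α H) (n : ℤ) {x : G}
    (hx : x ∈ H) : iter α n x ∈ H := by
  induction n with
  | zero => simpa using hx
  | succ n ih => simpa only [apply_iter] using h.apply_mem ih
  | pred n ih =>
    have := h.symm_apply_mem ih
    rwa [← iter_neg_one, iter_iter, show (-1 + -(n : ℤ)) = -n - 1 by ring] at this

theorem IsStable.inf {α : G ≃ₜ* G} {H K : Subgroup G} (hH : IsStable α H) (hK : IsStable α K) :
    IsStable α (H ⊓ K) :=
  isStable_of_mem (fun _ hx => ⟨hH.apply_mem hx.1, hK.apply_mem hx.2⟩)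
    fun _ hx => ⟨hH.symm_apply_mem hx.1, hK.symm_apply_mem hx.2⟩

theorem mem_map_iter {α : G ≃ₜ* G} {V : Subgroup G} {n : ℤ} {x : G} :
    x ∈ V.map (iter α n).toMonoidHom ↔ iter α (-n) x ∈ V := by
  constructor
  · rintro ⟨y, hy, rfl⟩
    have : iter α (-n) (iter α n y) ∈ V := by rwa [iter_neg_iter]
    exact this
  · intro h
    exact ⟨_, h, iter_iter_neg α n x⟩

theorem mem_plus {α : G ≃ₜ* G} {V : Subgroup G} {x : G} :
    x ∈ plus α V ↔ ∀ n : ℕ, iter α (-n) x ∈ V := by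
  simp only [plus, Subgroup.mem_iInf, mem_map_iter]

theorem mem_plusPlus {α : G ≃ₜ* G} {V : Subgroup G} {x : G} :
    x ∈ plusPlus α V ↔ ∃ m : ℕ, iter α (-m) x ∈ plus α V := by
  simp only [plusPlus, Set.mem_iUnion]
  refine exists_congr fun m => ⟨?_, fun h => ⟨_, h, iter_iter_neg α m x⟩⟩
  rintro ⟨y, hy, rfl⟩
  simpa only [iter_neg_iter, SetLike.mem_coe] using hy

theorem plus_symm (α : G ≃ₜ* G) (V : Subgroup G) : plus α.symm V = minus α V := by
  simp only [plus, minus, iter_symm]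

theorem plusPlus_symm (α : G ≃ₜ* G) (V : Subgroup G) :
    plusPlus α.symm V = minusMinus α V := by
  simp only [plusPlus, minusMinus, iter_symm, plus_symm]

theorem iter_neg_mem_plus {α : G ≃ₜ* G} {V : Subgroup G} {x : G} (hx : x ∈ plus α V) (k : ℕ) :
    iter α (-k) x ∈ plus α V := by
  rw [mem_plus] at hx ⊢
  intro n
  simpa [iter_iter, add_comm, neg_add] using hx (n + k)

theorem iter_mem_closure_orbit (α : G ≃ₜ* G) {x y : G}
    (hy : y ∈ closure (Set.range fun n : ℤ => iter α n x)) (m : ℤ) :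
    iter α m y ∈ closure (Set.range fun n : ℤ => iter α n x) := by
  refine map_mem_closure (continuous_iter α m) hy ?_
  rintro _ ⟨n, rfl⟩
  exact ⟨m + n, (iter_iter α m n x).symm⟩

theorem coe_iter_restrict (α : G ≃ₜ* G) (H : Subgroup G) (h : IsStable α H) (n : ℤ) (x : H) :
    (iter (restrict α H h) n x : G) = iter α n x := by
  induction n with
  | zero => simp
  | succ n ih =>
    rw [← apply_iter, ← apply_iter, ← ih]
    rfl
  | pred n ih =>
    rw [show -(n : ℤ) - 1 = -1 + -n by ring, ← iter_iter, ← iter_iter, ← ih, iter_neg_one,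
      iter_neg_one]
    rfl

theorem isClosed_plus {α : G ≃ₜ* G} {V : Subgroup G} (hV : IsClosed (V : Set G)) :
    IsClosed (plus α V : Set G) := by
  have : (plus α V : Set G) = ⋂ n : ℕ, iter α (-n) ⁻¹' (V : Set G) := by
    ext x
    simp [mem_plus]
  rw [this]
  exact isClosed_iInter fun n => hV.preimage (continuous_iter α _)

end Iter

/-! ### Tidy subgroups when all orbits are relatively compact -/

section Orbits

variable {G : Type*} [Group G] [TopologicalSpace G] [IsTopologicalGroup G]

theorem closure_orbit_subset_levi {α : G ≃ₜ* G} {x : G} (hx : x ∈ levi α) :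
    closure (Set.range fun n : ℤ => iter α n x) ⊆ levi α := by
  intro y hy
  refine IsCompact.of_isClosed_subset hx isClosed_closure ?_
  refine closure_minimal ?_ isClosed_closure
  rintro _ ⟨n, rfl⟩
  exact iter_mem_closure_orbit α hy n

theorem levi_restrict_levi (α : G ≃ₜ* G) :
    levi (restrict α (levi α) (isStable_levi α)) = ⊤ := by
  rw [eq_top_iff]
  rintro x -
  rw [mem_levi]
  have hx := mem_levi.1 x.2
  have hK : IsCompact ((Subtype.val : levi α → G) ⁻¹'
      closure (Set.range fun n : ℤ => iter α n (x : G))) := by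
    rw [Topology.IsInducing.subtypeVal.isCompact_iff]
    convert hx using 1
    exact Set.image_preimage_eq_of_subset fun y hy => ⟨⟨y, closure_orbit_subset_levi x.2 hy⟩, rfl⟩
  refine hK.of_isClosed_subset isClosed_closure ?_
  refine closure_minimal ?_ (isClosed_closure.preimage continuous_subtype_val)
  rintro _ ⟨n, rfl⟩
  simp only [Set.mem_preimage, coe_iter_restrict]
  exact subset_closure ⟨n, rfl⟩

/-- Baire category: the closed group `V₊₊` is the increasing union of the closed subgroups `αᵐ(V₊)`,
so one of them is relatively open. The compact orbit closure of `x` lies in `V₊₊`, hence in a single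
`αᴹ(V₊)`. -/
theorem apply_mem_plus_of_isClosed_plusPlus [LocallyCompactSpace G] {α : G ≃ₜ* G}
    (hlevi : levi α = ⊤) {V : Subgroup G} (hV : IsClosed (V : Set G))
    (hcl : IsClosed (plusPlus α V)) {x : G} (hx : x ∈ plus α V) : α x ∈ plus α V := by
  let T : ℕ → Subgroup G := fun m => (plus α V).comap (iter α (-m)).toMonoidHom
  have memT : ∀ m y, y ∈ T m ↔ iter α (-m) y ∈ plus α V := fun _ _ => Iff.rfl
  have hT : Monotone T := by
    refine monotone_nat_of_le_succ fun m y hy => ?_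
    rw [memT] at hy ⊢
    have := iter_neg_mem_plus hy 1
    rw [iter_iter] at this
    convert this using 3
    push_cast
    ring
  have hTc : ∀ m, IsClosed (T m : Set G) := fun m =>
    (isClosed_plus hV).preimage (continuous_iter α _)
  let S : Subgroup G := ⨆ m, T m
  have memS : ∀ y, y ∈ S ↔ ∃ m, y ∈ T m := fun y =>
    Subgroup.mem_iSup_of_directed hT.directed_le
  have hSset : (S : Set G) = plusPlus α V := by
    ext y
    rw [SetLike.mem_coe, memS, mem_plusPlus]
    rfl
  have hS : IsClosed (S : Set G) := hSset ▸ hcl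
  have hopen : ∃ m, ∃ O ∈ 𝓝 (1 : G), ∀ y ∈ O, y ∈ S → y ∈ T m := by
    have : LocallyCompactSpace S := hS.isClosedEmbedding_subtypeVal.locallyCompactSpace
    obtain ⟨m, y, hy⟩ := nonempty_interior_of_iUnion_of_closed
      (f := fun m => ((T m).subgroupOf S : Set S))
      (fun m => (hTc m).preimage continuous_subtype_val) (by
        ext y
        simpa [Subgroup.mem_subgroupOf] using (memS y).1 y.2)
    have h1 := Subgroup.isOpen_of_mem_nhds _ (mem_interior_iff_mem_nhds.1 hy)
    obtain ⟨O, hO, hOS⟩ := mem_nhds_subtype _ _ _ |>.1 (h1.mem_nhds (one_mem _))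
    exact ⟨m, O, hO, fun y hyO hyS => hOS (a := ⟨y, hyS⟩) hyO⟩
  obtain ⟨m, O, hO, hOT⟩ := hopen
  let C := closure (Set.range fun n : ℤ => iter α n x)
  have hC : IsCompact C := mem_levi.1 (hlevi ▸ Subgroup.mem_top x)
  have horb : ∀ n : ℤ, iter α n x ∈ S := by
    intro n
    rw [memS]
    refine ⟨n.toNat, ?_⟩
    rw [memT, iter_iter]
    have := iter_neg_mem_plus hx (n.toNat - n).toNat
    convert this using 3
    omega
  have hCS : C ⊆ S := closure_minimal (by rintro _ ⟨n, rfl⟩; exact horb n) hS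
  obtain ⟨M, hM⟩ : ∃ M, C ∩ S ⊆ T M := by
    refine hC.induction_on (p := fun s => ∃ M, s ∩ S ⊆ T M) ⟨0, by simp⟩ ?_ ?_ ?_
    · rintro s t hst ⟨M, hM⟩
      exact ⟨M, (Set.inter_subset_inter_left _ hst).trans hM⟩
    · rintro s t ⟨M, hM⟩ ⟨M', hM'⟩
      refine ⟨max M M', ?_⟩
      rintro y ⟨hy | hy, hyS⟩
      · exact hT (le_max_left _ _) (hM ⟨hy, hyS⟩)
      · exact hT (le_max_right _ _) (hM' ⟨hy, hyS⟩)
    · intro c hc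
      obtain ⟨k, hk⟩ := (memS c).1 (hCS hc)
      refine ⟨(fun y => c⁻¹ * y) ⁻¹' O, mem_nhdsWithin_of_mem_nhds ?_, max k m, ?_⟩
      · refine (continuous_const_mul c⁻¹).continuousAt.preimage_mem_nhds ?_
        simpa using hO
      · rintro y ⟨hy, hyS⟩
        have h1 : c⁻¹ * y ∈ T m := hOT _ hy (mul_mem (inv_mem (hCS hc)) hyS)
        have h2 := mul_mem (hT (le_max_left k m) hk) (hT (le_max_right k m) h1)
        simpa using h2
  -- The exponent `M + 1` exceeds `M` by one, so applying `α⁻ᴹ` leaves exactly `α x ∈ V₊`.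
  have := hM ⟨subset_closure ⟨(M : ℤ) + 1, rfl⟩, horb _⟩
  rw [SetLike.mem_coe, memT] at this
  simp only [iter_iter] at this
  rwa [neg_add_cancel_left, iter_one] at this

variable [T2Space G]

theorem IsTidySubgroup.isStable {α : G ≃ₜ* G} (hlevi : levi α = ⊤) {V : Subgroup G}
    (hV : IsTidySubgroup α V) : IsStable α V := by
  -- Local compactness is read off from `V`: this is applied to `M_α`, which is not known to be
  -- closed.
  have : LocallyCompactSpace G := hV.isCompact.locallyCompactSpace_of_mem_nhds_of_group
    (hV.isOpen.mem_nhds (one_mem V))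
  have hlevi' : levi α.symm = ⊤ := by
    rw [eq_top_iff]
    rintro x -
    have h : x ∈ levi α := hlevi ▸ Subgroup.mem_top x
    rw [mem_levi] at h ⊢
    simp only [iter_symm]
    rwa [← (Equiv.neg ℤ).surjective.range_comp (fun n => iter α n x)] at h
  have hVc := hV.isCompact.isClosed
  have hp : ∀ x ∈ plus α V, α x ∈ plus α V := fun x hx =>
    apply_mem_plus_of_isClosed_plusPlus hlevi hVc hV.isClosed_plusPlus hx
  have hm : ∀ x ∈ minus α V, α.symm x ∈ minus α V := by
    intro x hx
    rw [← plus_symm] at hx ⊢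
    exact apply_mem_plus_of_isClosed_plusPlus hlevi' hVc
      (by rw [plusPlus_symm]; exact hV.isClosed_minusMinus) hx
  have hp' : ∀ x ∈ plus α V, α.symm x ∈ plus α V := fun x hx => by
    simpa [iter_neg_one] using iter_neg_mem_plus hx 1
  have hm' : ∀ x ∈ minus α V, α x ∈ minus α V := fun x hx => by
    rw [← plus_symm] at hx ⊢
    simpa [iter_symm, iter_one] using iter_neg_mem_plus hx 1
  have mem : ∀ x, x ∈ V ↔ x ∈ (plus α V : Set G) * (minus α V : Set G) := fun x => by
    rw [← hV.eq_mul, SetLike.mem_coe]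
  refine isStable_of_mem ?_ ?_
  · intro x hx
    obtain ⟨a, ha, b, hb, rfl⟩ := (mem x).1 hx
    exact (mem _).2 ⟨α a, hp a ha, α b, hm' b hb, (map_mul α a b).symm⟩
  · intro x hx
    obtain ⟨a, ha, b, hb, rfl⟩ := (mem x).1 hx
    exact (mem _).2 ⟨α.symm a, hp' a ha, α.symm b, hm b hb, (map_mul α.symm a b).symm⟩

/-- A compact `α`-stable subgroup has arbitrarily small relatively open `α`-stable subgroups if
`α` is tidy on its Levi factor. -/
theorem exists_isStable_subgroup {α : G ≃ₜ* G}
    (htidy : IsTidy (restrict α (levi α) (isStable_levi α))) {K : Subgroup G}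
    (hKc : IsCompact (K : Set G)) (hK : IsStable α K) {Y : Set G} (hY : Y ∈ 𝓝 1) :
    ∃ W : Subgroup G, W ≤ K ∧ IsStable α W ∧ IsClosed (W : Set G) ∧ (W : Set G) ⊆ Y ∧
      ∃ O ∈ 𝓝 (1 : G), ∀ x ∈ O, x ∈ K → x ∈ W := by
  have hKM : K ≤ levi α := by
    intro x hx
    refine hKc.of_isClosed_subset isClosed_closure (closure_minimal ?_ hKc.isClosed)
    rintro _ ⟨n, rfl⟩
    exact hK.iter_mem n hx
  obtain ⟨V, hV, hVY⟩ := htidy (Subtype.val ⁻¹' Y)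
    (continuous_subtype_val.continuousAt.preimage_mem_nhds (by simpa using hY))
  have hVs := hV.isStable (levi_restrict_levi α)
  have hs : IsStable α (V.map (levi α).subtype) := by
    refine isStable_of_mem ?_ ?_
    · rintro _ ⟨x, hx, rfl⟩
      exact ⟨_, hVs.apply_mem hx, rfl⟩
    · rintro _ ⟨x, hx, rfl⟩
      exact ⟨_, hVs.symm_apply_mem hx, rfl⟩
  obtain ⟨O, hO, hOV⟩ := mem_nhds_subtype _ _ _ |>.1 (hV.isOpen.mem_nhds (one_mem V))
  refine ⟨V.map (levi α).subtype ⊓ K, inf_le_right, hs.inf hK, ?_, ?_, O, hO, ?_⟩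
  · exact (hV.isCompact.image continuous_subtype_val).isClosed.inter hKc.isClosed
  · rintro _ ⟨⟨x, hx, rfl⟩, -⟩
    exact hVY hx
  · intro x hxO hxK
    exact ⟨⟨⟨x, hKM hxK⟩, hOV (a := ⟨x, hKM hxK⟩) hxO, rfl⟩, hxK⟩

end Orbits

/-- Van Dantzig: take the stabilizer of a compact open identity neighbourhood under right
translation. -/
theorem exists_compact_open_subgroup (G : Type*) [Group G] [TopologicalSpace G]
    [IsTopologicalGroup G] [LocallyCompactSpace G] [TotallyDisconnectedSpace G] :
    ∃ V : Subgroup G, IsCompact (V : Set G) ∧ IsOpen (V : Set G) := by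
  obtain ⟨C, hC, hC1⟩ := exists_compact_mem_nhds (1 : G)
  obtain ⟨W, hW, h1W, hWC⟩ := loc_compact_Haus_tot_disc_of_zero_dim.mem_nhds_iff.1 hC1
  have hWc : IsCompact W := hC.of_isClosed_subset hW.isClosed hWC
  obtain ⟨T, hT, hWT⟩ := compact_open_separated_mul_right hWc hW.isOpen subset_rfl
  let V : Subgroup G :=
    { carrier := {g | ∀ w ∈ W, w * g ∈ W ∧ w * g⁻¹ ∈ W}
      one_mem' := fun w hw => by simpa using hw
      mul_mem' := fun {a b} ha hb w hw => by
        refine ⟨?_, ?_⟩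
        · simpa [mul_assoc] using (hb _ (ha w hw).1).1
        · simpa [mul_assoc] using (ha _ (hb w hw).2).2
      inv_mem' := fun {a} ha w hw => by simpa using (ha w hw).symm }
  have hV : (V : Set G) ∈ 𝓝 1 := by
    filter_upwards [hT, inv_mem_nhds_one G hT] with g hg hg' w hw
    exact ⟨hWT (Set.mul_mem_mul hw hg), hWT (Set.mul_mem_mul hw hg')⟩
  have hVo := V.isOpen_of_mem_nhds hV
  refine ⟨V, hWc.of_isClosed_subset (V.isClosed_of_isOpen hVo) fun g hg => ?_, hVo⟩
  simpa using (hg 1 h1W).1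

/-! ### Correcting a forward orbit by elements of `H` -/

variable {G : Type*} [Group G] [TopologicalSpace G]

/-- The sequence with `d₀ = d` and `dₙ₊₁ = cₙ α(dₙ)`. -/
def twistedOrbit (α : G ≃ₜ* G) (c : ℕ → G) (d : G) : ℕ → G
  | 0 => d
  | n + 1 => c n * α (twistedOrbit α c d n)

theorem twistedOrbit_mul (α : G ≃ₜ* G) (c : ℕ → G) (d e : G) (n : ℕ) :
    twistedOrbit α c (d * e) n = twistedOrbit α c d n * iter α n e := by
  induction n with
  | zero => simp [twistedOrbit]
  | succ n ih => simp [twistedOrbit, ih, mul_assoc, apply_iter]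

variable [IsTopologicalGroup G]

theorem continuous_twistedOrbit (α : G ≃ₜ* G) (c : ℕ → G) (n : ℕ) :
    Continuous fun d => twistedOrbit α c d n := by
  induction n with
  | zero => exact continuous_id
  | succ n ih => exact continuous_const.mul (α.continuous.comp ih)

/-- Finite segments are kept in `B` by adjusting the starting point; compactness of `B` then yields
one starting point for all times. -/
theorem exists_twistedOrbit_mem [T2Space G] (α : G ≃ₜ* G) {A B : Subgroup G}
    (hB : IsCompact (B : Set G)) (hAB : A ≤ B) (hA : ∀ a ∈ A, α.symm a ∈ A)
    (hext : ∀ d ∈ B, ∃ a ∈ A, α (d * a) ∈ B) {c : ℕ → G} (hc : ∀ n, c n ∈ B) :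
    ∃ d, ∀ n, twistedOrbit α c d n ∈ B := by
  have hA' : ∀ n : ℕ, ∀ a ∈ A, iter α (-n) a ∈ A := by
    intro n a ha
    induction n with
    | zero => simpa using ha
    | succ n ih =>
      have := hA _ ih
      rw [← iter_neg_one, iter_iter] at this
      convert this using 3
      push_cast
      ring
  have fin : ∀ n, ∃ d, ∀ j ≤ n, twistedOrbit α c d j ∈ B := by
    intro n
    induction n with
    | zero => exact ⟨1, fun j hj => by simp [Nat.le_zero.1 hj, twistedOrbit]⟩
    | succ n ih =>
      obtain ⟨d, hd⟩ := ih
      obtain ⟨a, ha, hda⟩ := hext _ (hd n le_rfl)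
      -- This multiplies the `n`-th term by `a` and each earlier term by some `α⁻ⁱ(a)`, which stays
      -- in `A ≤ B`.
      refine ⟨d * iter α (-n) a, fun j hj => ?_⟩
      rcases hj.eq_or_lt with rfl | hj
      · rw [twistedOrbit, twistedOrbit_mul, iter_iter_neg]
        exact mul_mem (hc n) hda
      · have hj' : j ≤ n := Nat.lt_succ_iff.1 hj
        rw [twistedOrbit_mul, iter_iter]
        refine mul_mem (hd j hj') (hAB ?_)
        have := hA' (n - j) a ha
        convert this using 3
        omega
  have key := IsCompact.nonempty_iInter_of_sequence_nonempty_isCompact_isClosed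
    (fun n => {d | ∀ j ≤ n, twistedOrbit α c d j ∈ B})
    (fun n d hd j hj => hd j (hj.trans n.le_succ)) fin
    (by
      refine hB.of_isClosed_subset ?_ fun d hd => hd 0 le_rfl
      simp only [Set.ofPred_forall]
      exact isClosed_iInter fun j => isClosed_iInter fun _ =>
        hB.isClosed.preimage (continuous_twistedOrbit α c j))
    (fun n => by
      simp only [Set.ofPred_forall]
      exact isClosed_iInter fun j => isClosed_iInter fun _ =>
        hB.isClosed.preimage (continuous_twistedOrbit α c j))
  obtain ⟨d, hd⟩ := key
  exact ⟨d, fun n => Set.mem_iInter.1 hd n n le_rfl⟩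

/-- Take `A = H ∩ V₊` and `B = H ∩ ⋂_{i ≤ N} αⁱ(V)`. These `B` decrease to `A`, so by compactness
`α(B) ⊆ V α(A)` for large `N`. An element of `A` thus corrects `d` so that its image lies in `V`,
the only condition for `B` not inherited from `d`. -/
theorem exists_extendable_subgroup [T2Space G] (α : G ≃ₜ* G) {V H : Subgroup G}
    (hVc : IsCompact (V : Set G)) (hVo : IsOpen (V : Set G)) (hHc : IsClosed (H : Set G))
    (hH : IsStable α H) :
    ∃ A B : Subgroup G, IsCompact (B : Set G) ∧ A ≤ B ∧ B ≤ V ⊓ H ∧ (∀ a ∈ A, α.symm a ∈ A) ∧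
      (∀ d ∈ B, ∃ a ∈ A, α (d * a) ∈ B) ∧ ∃ O ∈ 𝓝 (1 : G), ∀ x ∈ O, x ∈ H → x ∈ B := by
  let P : ℕ → Subgroup G := fun k =>
    H ⊓ ⨅ i : ℕ, ⨅ _ : i ≤ k, V.comap (iter α (-i)).toMonoidHom
  have memP : ∀ k x, x ∈ P k ↔ x ∈ H ∧ ∀ i : ℕ, i ≤ k → iter α (-i) x ∈ V := fun k x => by
    simp [P, Subgroup.mem_iInf]
  let A := H ⊓ plus α V
  have memA : ∀ x, x ∈ A ↔ x ∈ H ∧ ∀ i : ℕ, iter α (-i) x ∈ V := fun x => by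
    simp [A, mem_plus]
  have hAP : ∀ k, A ≤ P k := fun k x hx =>
    (memP k x).2 ⟨hx.1, fun i _ => ((memA x).1 hx).2 i⟩
  have hPV : ∀ k, P k ≤ V ⊓ H := fun k x hx => by
    have := (memP k x).1 hx
    exact ⟨by simpa using this.2 0 (Nat.zero_le k), this.1⟩
  have hPeq : ∀ k, (P k : Set G) = (H : Set G) ∩ ⋂ i : ℕ, ⋂ _ : i ≤ k, iter α (-i) ⁻¹' (V : Set G) := by
    intro k
    ext x
    simp [memP]
  have hPc : ∀ k, IsCompact (P k : Set G) := by
    intro k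
    refine hVc.of_isClosed_subset ?_ fun x hx => (hPV k hx).1
    rw [hPeq]
    exact hHc.inter (isClosed_iInter fun i => isClosed_iInter fun _ =>
      hVc.isClosed.preimage (continuous_iter α _))
  have hPanti : Antitone P := fun k l hkl x hx => by
    rw [memP] at hx ⊢
    exact ⟨hx.1, fun i hi => hx.2 i (hi.trans hkl)⟩
  obtain ⟨N, hN⟩ := exists_subset_nhds_of_isCompact (V := fun k => α '' (P k : Set G))
    (U := (V : Set G) * α '' (A : Set G))
    (Antitone.directed_ge fun k l hkl => Set.image_mono (hPanti hkl))
    (fun k => (hPc k).image α.continuous) (by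
      intro x hx
      refine hVo.mul_right.mem_nhds ⟨1, one_mem V, x, ⟨α.symm x, ?_, α.apply_symm_apply x⟩,
        one_mul x⟩
      have : ∀ k, α.symm x ∈ P k := fun k => by
        obtain ⟨y, hy, rfl⟩ := Set.mem_iInter.1 hx k
        exact (α.symm_apply_apply y).symm ▸ hy
      exact (memA _).2 ⟨((memP 0 _).1 (this 0)).1, fun i => ((memP i _).1 (this i)).2 i le_rfl⟩)
  refine ⟨A, P N, hPc N, hAP N, hPV N, ?_, ?_, ?_⟩
  · rintro x ⟨hx, hx'⟩
    refine ⟨hH.symm_apply_mem hx, ?_⟩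
    simpa [iter_neg_one] using iter_neg_mem_plus hx' 1
  · intro d hd
    obtain ⟨o, ho, _, ⟨a, ha, rfl⟩, hoa⟩ := hN ⟨d, hd, rfl⟩
    refine ⟨a⁻¹, inv_mem ha, ?_⟩
    have hda : d * a⁻¹ ∈ P N := mul_mem hd (inv_mem (hAP N ha))
    have hoe : α (d * a⁻¹) = o := by
      simp only at hoa
      rw [map_mul, map_inv, ← hoa, mul_inv_cancel_right]
    rw [memP] at hda ⊢
    refine ⟨hH.apply_mem hda.1, fun i hi => ?_⟩
    rcases i with _ | i
    · simpa [hoe] using ho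
    · rw [iter_apply]
      have := hda.2 i (by omega)
      convert this using 3
      push_cast
      ring
  · refine ⟨⋂ i ∈ Finset.range (N + 1), iter α (-(i : ℕ)) ⁻¹' (V : Set G), ?_, ?_⟩
    · refine (Filter.biInter_finset_mem _).2 fun i _ => ?_
      exact (hVo.preimage (continuous_iter α _)).mem_nhds (by simp [one_mem])
    · intro x hx hxH
      rw [memP]
      refine ⟨hxH, fun i hi => ?_⟩
      exact Set.mem_iInter₂.1 hx i (Finset.mem_range.2 (by omega))

theorem exists_forward_orbit_mem [T2Space G] (α : G ≃ₜ* G) {V H : Subgroup G}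
    (hVc : IsCompact (V : Set G)) (hVo : IsOpen (V : Set G)) (hHc : IsClosed (H : Set G))
    (hH : IsStable α H) {x : G} (hx : x ∈ contractionSetMod α (H : Set G)) :
    ∃ (N : ℕ) (u : G), (∀ n : ℕ, iter α n u ∈ V) ∧ ∃ h ∈ H, iter α N x = u * h := by
  obtain ⟨A, B, hB, hAB, hBV, hA, hext, O, hO, hOB⟩ :=
    exists_extendable_subgroup α hVc hVo hHc hH
  have hcont : Tendsto (fun p : G × G => p.1⁻¹ * α p.2) (𝓝 1 ×ˢ 𝓝 1) (𝓝 1) := by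
    have : Continuous fun p : G × G => p.1⁻¹ * α p.2 :=
      continuous_fst.inv.mul (α.continuous.comp continuous_snd)
    simpa [nhds_prod_eq] using this.tendsto (1, 1)
  obtain ⟨Y, hY, hYO⟩ := mem_prod_same_iff.1 (hcont hO)
  obtain ⟨N, hN⟩ := hx (Y ∩ V) (inter_mem hY (hVo.mem_nhds (one_mem V)))
  choose v hv h hh hvh using fun n : ℕ => hN (N + n) (Nat.le_add_right N n)
  simp only at hvh
  -- Writing `αᴺ⁺ⁿ(x) = vₙhₙ`, the defect of `(vₙ)` from being an orbit is in `H` and close to `1`.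
  -- The twisted orbit absorbs it: `αⁿ(v₀d) = vₙdₙ`.
  have hc : ∀ n, (v (n + 1))⁻¹ * α (v n) ∈ B := by
    intro n
    refine hOB _ (hYO (a := (v (n + 1), v n)) ⟨(hv _).1, (hv _).1⟩) ?_
    have : (v (n + 1))⁻¹ * α (v n) = h (n + 1) * (α (h n))⁻¹ := by
      have h1 : v (n + 1) * h (n + 1) = α (v n) * α (h n) := by
        rw [hvh, ← map_mul, hvh, apply_iter]
        push_cast
        rw [add_assoc]
      rw [inv_mul_eq_iff_eq_mul, ← mul_assoc, h1, mul_inv_cancel_right]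
    rw [this]
    exact mul_mem (hh _) (inv_mem (hH.apply_mem (hh n)))
  obtain ⟨d, hd⟩ := exists_twistedOrbit_mem α hB hAB hA hext hc
  have horb : ∀ n : ℕ, iter α n (v 0 * d) =
      v n * twistedOrbit α (fun n => (v (n + 1))⁻¹ * α (v n)) d n := by
    intro n
    induction n with
    | zero => simp [twistedOrbit]
    | succ n ih =>
      rw [twistedOrbit, ← mul_assoc, mul_inv_cancel_left, ← map_mul, ← ih, apply_iter]
      push_cast
      rfl
  refine ⟨N, v 0 * d, fun n => ?_, d⁻¹ * h 0, ?_, ?_⟩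
  · rw [horb]
    exact mul_mem (hv n).2 (hBV (hd n)).1
  · exact mul_mem (inv_mem (hBV (hd 0)).2) (hh 0)
  · have := hvh 0
    rw [add_zero] at this
    rw [← this]
    group

/-! ### Reduction to a compact stable subgroup -/

section StableCore

variable {G : Type*} [Group G] [TopologicalSpace G]

/-- The largest `α`-stable subgroup of `S`. -/
def stableCore (α : G ≃ₜ* G) (S : Subgroup G) : Subgroup G :=
  ⨅ n : ℤ, S.comap (iter α n).toMonoidHom

theorem mem_stableCore {α : G ≃ₜ* G} {S : Subgroup G} {x : G} :
    x ∈ stableCore α S ↔ ∀ n : ℤ, iter α n x ∈ S := by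
  simp [stableCore, Subgroup.mem_iInf]

theorem stableCore_le (α : G ≃ₜ* G) (S : Subgroup G) : stableCore α S ≤ S := fun x hx => by
  simpa using mem_stableCore.1 hx 0

theorem isStable_stableCore (α : G ≃ₜ* G) (S : Subgroup G) : IsStable α (stableCore α S) := by
  refine isStable_of_mem ?_ ?_ <;> intro x hx <;> rw [mem_stableCore] at hx ⊢ <;> intro n
  · rw [iter_apply]
    exact hx _
  · rw [← iter_neg_one, iter_iter]
    exact hx _

theorem isClosed_stableCore (α : G ≃ₜ* G) {S : Subgroup G} (hS : IsClosed (S : Set G)) :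
    IsClosed (stableCore α S : Set G) := by
  have : (stableCore α S : Set G) = ⋂ n : ℤ, iter α n ⁻¹' (S : Set G) := by
    ext x
    simp [mem_stableCore]
  rw [this]
  exact isClosed_iInter fun n => hS.preimage (continuous_iter α n)

theorem mul_mem_contractionSetMod {α : G ≃ₜ* G} {H : Subgroup G} (hH : IsStable α H) {x h : G}
    (hx : x ∈ contractionSetMod α (H : Set G)) (hh : h ∈ H) :
    x * h ∈ contractionSetMod α (H : Set G) := by
  intro V hV
  obtain ⟨N, hN⟩ := hx V hV
  refine ⟨N, fun n hn => ?_⟩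
  obtain ⟨v, hv, k, hk, hvk⟩ := hN n hn
  refine ⟨v, hv, k * iter α n h, mul_mem hk (hH.iter_mem n hh), ?_⟩
  simp only at hvk ⊢
  rw [map_mul, ← hvk, mul_assoc]

theorem iter_mem_contractionSetMod {α : G ≃ₜ* G} {H : Set G} {x : G}
    (hx : x ∈ contractionSetMod α H) (m : ℕ) : iter α m x ∈ contractionSetMod α H := by
  intro V hV
  obtain ⟨N, hN⟩ := hx V hV
  refine ⟨N, fun n hn => ?_⟩
  rw [iter_iter]
  exact_mod_cast hN (n + m) (by omega)

theorem iter_mem_contractionSet {α : G ≃ₜ* G} {x : G} (hx : x ∈ contractionSet α) (m : ℤ) :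
    iter α m x ∈ contractionSet α := by
  have h := ((continuous_iter α m).tendsto 1).comp hx
  rw [map_one] at h
  refine h.congr fun n => ?_
  rw [Function.comp_apply, iter_iter, iter_iter, add_comm]

variable [IsTopologicalGroup G]

/-- If `αⁿ(u) → 1` mod `H` and `y` is a cluster point of `αⁿ(u)`, then `y ∈ H`. -/
theorem mem_of_mapClusterPt {α : G ≃ₜ* G} {H : Subgroup G} (hH : IsClosed (H : Set G)) {u y : G}
    (hu : u ∈ contractionSetMod α (H : Set G))
    (hy : MapClusterPt y atTop fun n : ℕ => iter α n u) : y ∈ H := by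
  rw [← SetLike.mem_coe, ← hH.closure_eq, mem_closure_iff_nhds]
  intro Y hY
  have hcont : Tendsto (fun p : G × G => p.1⁻¹ * p.2) (𝓝 1 ×ˢ 𝓝 y) (𝓝 y) := by
    have : Continuous fun p : G × G => p.1⁻¹ * p.2 := continuous_fst.inv.mul continuous_snd
    simpa [nhds_prod_eq] using this.tendsto (1, y)
  obtain ⟨V, hV, Y', hY', hVY⟩ := mem_prod_iff.1 (hcont hY)
  obtain ⟨N, hN⟩ := hu V hV
  obtain ⟨n, hn, hnY⟩ := frequently_atTop.1 (hy.frequently hY') N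
  obtain ⟨v, hv, h, hh, hvh⟩ := hN n hn
  refine ⟨h, ?_, hh⟩
  have : v⁻¹ * iter α n u ∈ Y := hVY (a := (v, iter α n u)) ⟨hv, hnY⟩
  simp only at hvh
  rwa [← hvh, inv_mul_cancel_left] at this

/-- If this fails, the orbit has a cluster point outside an open set `Y'K`. Its two-sided orbit lies
in `V`, since negative shifts of late iterates are still forward iterates, and it lies in `H`; so
the point is in `K`, a contradiction. -/
theorem mem_contractionSetMod_stableCore {α : G ≃ₜ* G} {V H : Subgroup G}
    (hVc : IsCompact (V : Set G)) (hVcl : IsClosed (V : Set G)) (hHc : IsClosed (H : Set G))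
    (hH : IsStable α H) {u : G} (hu : u ∈ contractionSetMod α (H : Set G))
    (huV : ∀ n : ℕ, iter α n u ∈ V) :
    u ∈ contractionSetMod α (stableCore α (V ⊓ H) : Set G) := by
  intro Y hY
  set K := stableCore α (V ⊓ H)
  obtain ⟨Y', hY'Y, hY'o, h1⟩ := mem_nhds_iff.1 hY
  suffices h : ∀ᶠ n : ℕ in atTop, iter α n u ∈ Y' * (K : Set G) by
    obtain ⟨N, hN⟩ := eventually_atTop.1 h
    exact ⟨N, fun n hn => Set.mul_subset_mul_right hY'Y (hN n hn)⟩
  by_contra hcon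
  have hfreq : ∃ᶠ n : ℕ in atTop, iter α n u ∈ (V : Set G) \ (Y' * (K : Set G)) :=
    (not_eventually.1 hcon).mono fun n hn => ⟨huV n, hn⟩
  obtain ⟨y, hy, hyc⟩ := (hVc.diff hY'o.mul_right).exists_mapClusterPt_of_frequently hfreq
  refine hy.2 ⟨1, h1, y, mem_stableCore.2 fun m => ⟨?_, ?_⟩, one_mul y⟩
  · have hm : MapClusterPt (iter α m y) atTop fun n : ℕ => iter α m (iter α n u) :=
      hyc.continuousAt_comp (continuous_iter α m).continuousAt
    refine hVcl.closure_subset (mem_closure_iff_nhds.2 fun Z hZ => ?_)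
    obtain ⟨n, hn, hnZ⟩ := frequently_atTop.1 (hm.frequently hZ) m.natAbs
    refine ⟨_, hnZ, ?_⟩
    rw [iter_iter]
    have := huV (m + n).toNat
    rwa [Int.toNat_of_nonneg (by omega)] at this
  · exact hH.iter_mem m (mem_of_mapClusterPt hHc hu hyc)

end StableCore

/-! ### Contraction modulo a compact stable subgroup -/

section CompactCase

variable {G : Type*} [Group G] [TopologicalSpace G] [IsTopologicalGroup G]

/-- The defects `vₙ₊₁⁻¹ α(vₙ)` are small elements of `K`, hence lie in `W`; by stability of `W` they
accumulate to `αⁿ(v₀) ∈ vₙW`. Here `k` may still depend on `V`. -/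
theorem exists_mul_mem_of_relatively_open {α : G ≃ₜ* G} {K W : Subgroup G} (hK : IsStable α K)
    (hW : IsStable α W) {O : Set G} (hO : O ∈ 𝓝 1)
    (hOW : ∀ x ∈ O, x ∈ K → x ∈ W) {u : G} (hu : u ∈ contractionSetMod α (K : Set G))
    {V : Set G} (hV : V ∈ 𝓝 1) :
    ∃ k ∈ K, ∃ N : ℕ, ∀ n : ℕ, N ≤ n → iter α n (u * k) ∈ V * (W : Set G) := by
  have hcont : Tendsto (fun p : G × G => p.1⁻¹ * α p.2) (𝓝 1 ×ˢ 𝓝 1) (𝓝 1) := by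
    have : Continuous fun p : G × G => p.1⁻¹ * α p.2 :=
      continuous_fst.inv.mul (α.continuous.comp continuous_snd)
    simpa [nhds_prod_eq] using this.tendsto (1, 1)
  obtain ⟨Y, hY, hYO⟩ := mem_prod_same_iff.1 (hcont hO)
  obtain ⟨N, hN⟩ := hu (Y ∩ V) (inter_mem hY hV)
  choose v hv h hh hvh using fun n : ℕ => hN (N + n) (Nat.le_add_right N n)
  simp only at hvh
  have hc : ∀ n, (v (n + 1))⁻¹ * α (v n) ∈ W := by
    intro n
    refine hOW _ (hYO (a := (v (n + 1), v n)) ⟨(hv _).1, (hv _).1⟩) ?_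
    have : (v (n + 1))⁻¹ * α (v n) = h (n + 1) * (α (h n))⁻¹ := by
      have h1 : v (n + 1) * h (n + 1) = α (v n) * α (h n) := by
        rw [hvh, ← map_mul, hvh, apply_iter]
        push_cast
        rw [add_assoc]
      rw [inv_mul_eq_iff_eq_mul, ← mul_assoc, h1, mul_inv_cancel_right]
    rw [this]
    exact mul_mem (hh _) (inv_mem (hK.apply_mem (hh n)))
  have horb : ∀ n : ℕ, (v n)⁻¹ * iter α n (v 0) ∈ W := by
    intro n
    induction n with
    | zero => simp
    | succ n ih =>
      have := mul_mem (hc n) (hW.apply_mem ih)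
      rwa [map_mul, map_inv, apply_iter, mul_assoc, mul_inv_cancel_left] at this
  -- Chosen so that `αᴺ(uk) = v₀`.
  refine ⟨(iter α (-N) (h 0))⁻¹, inv_mem (hK.iter_mem _ (hh 0)), N, fun n hn => ?_⟩
  obtain ⟨m, rfl⟩ := Nat.exists_eq_add_of_le hn
  have h0 : u = iter α (-N) (v 0) * iter α (-N) (h 0) := by
    have := hvh 0
    rw [add_zero] at this
    rw [← map_mul, this, iter_neg_iter]
  refine ⟨v m, (hv m).2, _, horb m, ?_⟩
  simp only
  rw [mul_inv_cancel_left, h0, mul_inv_cancel_right, iter_iter]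
  congr 2
  push_cast
  ring

/-- Being in `YW` at a single common time already determines `kW`, so the elements found for
different neighbourhoods all lie in one coset. -/
theorem exists_coset_of_relatively_open {α : G ≃ₜ* G} {K W : Subgroup G} (hK : IsStable α K)
    (hWK : W ≤ K) (hW : IsStable α W) {O : Set G} (hO : O ∈ 𝓝 1)
    (hOW : ∀ x ∈ O, x ∈ K → x ∈ W) {u : G} (hu : u ∈ contractionSetMod α (K : Set G)) :
    ∃ k ∈ K, ∀ k' ∈ K, u * k' ∈ contractionSetMod α (W : Set G) ↔ k⁻¹ * k' ∈ W := by
  have hcont : Tendsto (fun p : G × G => p.1⁻¹ * p.2) (𝓝 1 ×ˢ 𝓝 1) (𝓝 1) := by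
    have : Continuous fun p : G × G => p.1⁻¹ * p.2 := continuous_fst.inv.mul continuous_snd
    simpa [nhds_prod_eq] using this.tendsto (1, 1)
  obtain ⟨Y, hY, hYO⟩ := mem_prod_same_iff.1 (hcont hO)
  have uniq : ∀ k ∈ K, ∀ k' ∈ K, ∀ n : ℕ, iter α n (u * k) ∈ Y * (W : Set G) →
      iter α n (u * k') ∈ Y * (W : Set G) → k⁻¹ * k' ∈ W := by
    rintro k hk k' hk' n ⟨v, hv, w, hw, hvw⟩ ⟨v', hv', w', hw', hvw'⟩
    simp only at hvw hvw'
    have hq : iter α n (k⁻¹ * k') = w⁻¹ * (v⁻¹ * v') * w' := by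
      have : k⁻¹ * k' = (u * k)⁻¹ * (u * k') := by group
      rw [this, map_mul, map_inv, ← hvw, ← hvw']
      group
    have hq' : v⁻¹ * v' = w * iter α n (k⁻¹ * k') * w'⁻¹ := by
      rw [hq]
      group
    have hvv : v⁻¹ * v' ∈ W := by
      refine hOW _ (hYO (a := (v, v')) ⟨hv, hv'⟩) ?_
      rw [hq']
      exact mul_mem (mul_mem (hWK hw) (hK.iter_mem n (mul_mem (inv_mem hk) hk')))
        (inv_mem (hWK hw'))
    have := hW.iter_mem (-n) (hq ▸ mul_mem (mul_mem (inv_mem hw) hvv) hw')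
    rwa [iter_neg_iter] at this
  obtain ⟨k, hk, N, hN⟩ := exists_mul_mem_of_relatively_open hK hW hO hOW hu hY
  have hkW : u * k ∈ contractionSetMod α (W : Set G) := by
    intro V hV
    obtain ⟨k', hk', N', hN'⟩ :=
      exists_mul_mem_of_relatively_open hK hW hO hOW hu (inter_mem hV hY)
    have hkk : k'⁻¹ * k ∈ W := uniq k' hk' k hk (max N N')
      (Set.mul_subset_mul_right Set.inter_subset_right (hN' _ (le_max_right _ _)))
      (hN _ (le_max_left _ _))
    refine ⟨N', fun n hn => ?_⟩
    obtain ⟨v, hv, w, hw, hvw⟩ := hN' n hn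
    refine ⟨v, hv.1, w * iter α n (k'⁻¹ * k), mul_mem hw (hW.iter_mem n hkk), ?_⟩
    simp only at hvw ⊢
    rw [← mul_assoc, hvw, ← map_mul]
    congr 1
    group
  refine ⟨k, hk, fun k' hk' => ⟨fun h => ?_, fun h => ?_⟩⟩
  · obtain ⟨N', hN'⟩ := h Y hY
    exact uniq k hk k' hk' (max N N') (hN _ (le_max_left _ _)) (hN' _ (le_max_right _ _))
  · have := mul_mem_contractionSetMod hW hkW h
    rwa [mul_assoc, mul_inv_cancel_left] at this

theorem exists_mul_mem_contractionSet_of_isCompact [T2Space G] {α : G ≃ₜ* G}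
    (htidy : IsTidy (restrict α (levi α) (isStable_levi α))) {K : Subgroup G}
    (hKc : IsCompact (K : Set G)) (hK : IsStable α K) {u : G}
    (hu : u ∈ contractionSetMod α (K : Set G)) : ∃ k ∈ K, u * k ∈ contractionSet α := by
  let I := {W : Subgroup G // W ≤ K ∧ IsStable α W ∧ IsClosed (W : Set G) ∧
    ∃ O ∈ 𝓝 (1 : G), ∀ x ∈ O, x ∈ K → x ∈ W}
  have hI : Nonempty I :=
    ⟨⟨K, le_rfl, hK, hKc.isClosed, Set.univ, univ_mem, fun _ _ h => h⟩⟩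
  let T : I → Set G := fun W => {k | k ∈ K ∧ u * k ∈ contractionSetMod α (W.1 : Set G)}
  have hT : ∀ W : I, ∃ k ∈ K, T W = (K : Set G) ∩ (fun k' => k⁻¹ * k') ⁻¹' (W.1 : Set G) := by
    rintro ⟨W, hWK, hW, -, O, hO, hOW⟩
    obtain ⟨k, hk, h⟩ := exists_coset_of_relatively_open hK hWK hW hO hOW hu
    exact ⟨k, hk, Set.ext fun k' => and_congr_right fun hk' => h k' hk'⟩
  have hTc : ∀ W, IsClosed (T W) := fun W => by
    obtain ⟨k, -, h⟩ := hT W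
    rw [h]
    exact hKc.isClosed.inter (W.2.2.2.1.preimage (continuous_const_mul _))
  obtain ⟨k, hk⟩ := IsCompact.nonempty_iInter_of_directed_nonempty_isCompact_isClosed T
    (by
      rintro ⟨W, hWK, hW, hWc, O, hO, hOW⟩ ⟨W', hWK', hW', hWc', O', hO', hOW'⟩
      refine ⟨⟨W ⊓ W', inf_le_left.trans hWK, hW.inf hW', hWc.inter hWc', O ∩ O',
        inter_mem hO hO', fun x hx hxK => ⟨hOW x hx.1 hxK, hOW' x hx.2 hxK⟩⟩, ?_, ?_⟩
      · rintro k ⟨hk, h⟩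
        refine ⟨hk, fun V hV => (h V hV).imp fun N hN n hn => ?_⟩
        exact Set.mul_subset_mul_left (fun _ hx => hx.1) (hN n hn)
      · rintro k ⟨hk, h⟩
        refine ⟨hk, fun V hV => (h V hV).imp fun N hN n hn => ?_⟩
        exact Set.mul_subset_mul_left (fun _ hx => hx.2) (hN n hn))
    (fun W => by
      obtain ⟨k, hk, h⟩ := hT W
      refine ⟨k, ?_⟩
      rw [h]
      exact ⟨hk, by simp [one_mem]⟩)
    (fun W => hKc.of_isClosed_subset (hTc W) fun k hk => hk.1)
    hTc
  have hk := Set.mem_iInter.1 hk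
  refine ⟨k, (hk hI.some).1, ?_⟩
  intro Y hY
  have hcont : Tendsto (fun p : G × G => p.1 * p.2) (𝓝 1 ×ˢ 𝓝 1) (𝓝 1) := by
    simpa [nhds_prod_eq] using (continuous_mul (M := G)).tendsto (1, 1)
  obtain ⟨V, hV, hVY⟩ := mem_prod_same_iff.1 (hcont hY)
  -- Tidiness enters only here: `W` can be taken inside `V`, so convergence modulo `W` becomes
  -- convergence to `1`.
  obtain ⟨W, hWK, hW, hWc, hWV, hWO⟩ := exists_isStable_subgroup htidy hKc hK hV
  obtain ⟨N, hN⟩ := (hk ⟨W, hWK, hW, hWc, hWO⟩).2 V hV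
  refine mem_map.2 (mem_atTop_sets.2 ⟨N, fun n hn => ?_⟩)
  obtain ⟨v, hv, w, hw, hvw⟩ := hN n hn
  have : v * w ∈ Y := hVY (a := (v, w)) ⟨hv, hWV hw⟩
  simp only at hvw
  rwa [hvw] at this

end CompactCase

end TidyAut

theorem lemma1 {G : Type*} [Group G] [TopologicalSpace G] [IsTopologicalGroup G]
    [LocallyCompactSpace G] [TotallyDisconnectedSpace G] (α : G ≃ₜ* G)
    (H : Subgroup G) (hHclosed : IsClosed (H : Set G)) (hHstable : TidyAut.IsStable α H)
    (htidy : TidyAut.IsTidy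
      (TidyAut.restrict α (TidyAut.levi α) (TidyAut.isStable_levi α))) :
    TidyAut.contractionSetMod α (H : Set G) =
      TidyAut.contractionSet α * (H : Set G) := by
  open TidyAut in
  apply Set.Subset.antisymm
  · intro x hx
    obtain ⟨V, hVc, hVo⟩ := exists_compact_open_subgroup G
    obtain ⟨N, u, huV, h, hh, hxu⟩ := exists_forward_orbit_mem α hVc hVo hHclosed hHstable hx
    have hu : u ∈ contractionSetMod α (H : Set G) := by
      have := mul_mem_contractionSetMod hHstable (iter_mem_contractionSetMod hx N) (inv_mem hh)
      rwa [hxu, mul_inv_cancel_right] at this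
    have huK := mem_contractionSetMod_stableCore hVc hVc.isClosed hHclosed hHstable hu huV
    obtain ⟨k, hk, huk⟩ := exists_mul_mem_contractionSet_of_isCompact htidy
      (hVc.of_isClosed_subset (isClosed_stableCore α (S := V ⊓ H) (hVc.isClosed.inter hHclosed))
        fun y hy => (stableCore_le _ _ hy).1) (isStable_stableCore _ _) huK
    refine ⟨iter α (-N) (u * k), iter_mem_contractionSet huk _, iter α (-N) (k⁻¹ * h),
      hHstable.iter_mem _ (mul_mem (inv_mem (stableCore_le _ _ hk).2) hh), ?_⟩
    simp only
    rw [← map_mul, mul_assoc, mul_inv_cancel_left, ← hxu, iter_neg_iter]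
  · rintro _ ⟨u, hu, h, hh, rfl⟩ V hV
    obtain ⟨N, hN⟩ := mem_atTop_sets.1 (mem_map.1 (hu hV))
    exact ⟨N, fun n hn => ⟨_, hN n hn, _, hHstable.iter_mem n hh, (map_mul _ u h).symm⟩⟩
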